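/- Let $X,Y$ be finite-dimensional complex Hilbert spaces with fixed standard bases, let $\mathcal N:\mathscr L(X)\to\mathscr L(Y)$ be a quantum channel (a completely positive, trace-preserving linear map), let $k\ge 1$ and $\alpha\in(1,\infty)$. For a linear map $\mathcal M:\mathscr L(X)\to\mathscr L(Y)$ let $J^{\mathcal M}=\sum_{x,x'}|x\rangle\langle x'|\otimes\mathcal M(|x\rangle\langle x'|)$ be its Choi matrix, and similarly for maps $\mathscr L(X^{\otimes k})\to\mathscr L(Y^{\otimes k})$; let $\mathscr P(\cdot)$ denote positive semidefinite operators, $\le$ the Loewner order, $\|\cdot\|_\infty$ the operator norm, and $T_{Y^{\otimes k}}$ the partial transpose on $Y^{\otimes k}$. For $\beta\in(0,1)$ let $P\#_\beta Q=P^{1/2}(P^{-1/2}QP^{-1/2})^{\beta}P^{1/2}$ for positive definite $P,Q$, and $P\#_\beta Q=\lim_{\varepsilon\downarrow 0}(P+\varepsilon I)\#_\beta(Q+\varepsilon I)$ for positive semidefinite $P,Q$. Consider the convex program that defines $\Upsilon(\mathrm D^{\#}_\alpha,k)(\mathcal N)$: $$\begin{aligned} \Upsilon(\mathrm D^{\#}_\alpha,k)(\mathcal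 N)=\frac1{\alpha-1}\log\ \min\quad & \|\mathrm{tr}_{Y^{\otimes k}}(A)\|_\infty\\ \text{s.t.}\quad & J^{\mathcal N^{\otimes k}}\le J^{\mathcal M}\,\#_{1/\alpha}\,A,\\ & R\pm (J^{\mathcal M})^{T_{Y^{\otimes k}}}\ge 0,\\ & (I_{X^{\otimes k}}\otimes S)\pm R^{T_{Y^{\otimes k}}}\ge 0,\\ & \mathrm{tr}(S)\le 1,\\ & A,J^{\mathcal M},R\in\mathscr P(X^{\otimes k}\otimes Y^{\otimes k}),\quad S\in\mathscr P(Y^{\otimes k}), \end{aligned}$$ over the variables $A,R,J^{\mathcal M},S$. The symmetric group $\mathfrak S_k$ acts on $X^{\otimes k}$ and on $Y^{\otimes k}$ by permuting the tensor factors, through permutation matrices $P_X(\pi)$ and $P_Y(\pi)$, and on $X^{\otimes k}\otimes Y^{\otimes k}$ through $P_X(\pi)\otimes P_Y(\pi)$; $\mathrm{End}^{\mathfrak S_k}(\cdot)$ denotes the operators that commute with the action. Then the program has an optimal solution $(A,R,J^{\mathcal M},S)$ (in particular the minimum is attained) with $A,R,J^{\mathcal M}\in\mathrm{End}^{\mathfrak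 S_k}(X^{\otimes k}\otimes Y^{\otimes k})$ and $S\in\mathrm{End}^{\mathfrak S_k}(Y^{\otimes k})$. -/

import Mathlib

open Filter
open scoped Matrix Kronecker Topology ComplexOrder

noncomputable section

/-! Finite-dimensional complex Hilbert spaces are given in their standard bases: the space with
basis indexed by `X` has operators `Matrix X X ℂ`; the tensor product of the spaces indexed by
`X` and `Y` is indexed by `X × Y`, and the `k`-fold tensor power of the space indexed by `X` is
indexed by `Fin k → X`, the index `x` standing for the vector `x 0 ⊗ ⋯ ⊗ x (k - 1)`. -/

/-- The Loewner order: `A ≤ B` if `B - A` is positive semidefinite. -/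
def LoewnerLE {n : Type*} (A B : Matrix n n ℂ) : Prop := (B - A).PosSemidef

/-- The real power `A ^ s` of a (positive definite) matrix, by functional calculus. -/
def matPow {n : Type*} [Fintype n] [DecidableEq n] (A : Matrix n n ℂ) (s : ℝ) : Matrix n n ℂ :=
  cfc (fun x : ℝ => x ^ s) A

/-- The weighted geometric mean of two positive definite matrices:
`A^(1/2) (A^(-1/2) B A^(-1/2))^β A^(1/2)`. -/
def posGeomMean {n : Type*} [Fintype n] [DecidableEq n] (β : ℝ) (A B : Matrix n n ℂ) :
    Matrix n n ℂ :=
  matPow A (1 / 2) * matPow (matPow A (-(1 / 2)) * B * matPow A (-(1 / 2))) β * matPow A (1 / 2)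

/-- The weighted geometric mean of two positive semidefinite matrices, the usual extension of
`posGeomMean`: the limit of the means of `A + ε I` and `B + ε I` as `ε` decreases to `0`. -/
def geomMean {n : Type*} [Fintype n] [DecidableEq n] (β : ℝ) (A B : Matrix n n ℂ) :
    Matrix n n ℂ :=
  limUnder (𝓝[>] (0 : ℝ)) fun ε : ℝ =>
    posGeomMean β (A + (ε : ℂ) • (1 : Matrix n n ℂ)) (B + (ε : ℂ) • (1 : Matrix n n ℂ))

/-- The operator norm with respect to the Euclidean norm. -/
def opNorm {n : Type*} [Fintype n] [DecidableEq n] (A : Matrix n n ℂ) : ℝ :=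
  ‖Matrix.toEuclideanCLM (𝕜 := ℂ) A‖

/-- The partial trace over the second tensor factor. -/
def partialTraceRight {m n : Type*} [Fintype n] (A : Matrix (m × n) (m × n) ℂ) :
    Matrix m m ℂ :=
  Matrix.of fun i i' => ∑ j, A (i, j) (i', j)

/-- The partial transpose on the second tensor factor. -/
def partialTransposeRight {m n : Type*} (A : Matrix (m × n) (m × n) ℂ) :
    Matrix (m × n) (m × n) ℂ :=
  Matrix.of fun p q => A (p.1, q.2) (q.1, p.2)

/-- Complete positivity: for every `r`, the map `id_r ⊗ N` preserves positive
semidefiniteness. -/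
def IsCompletelyPositive {X Y : Type*} (N : Matrix X X ℂ →ₗ[ℂ] Matrix Y Y ℂ) : Prop :=
  ∀ (r : ℕ) (P : Matrix (Fin r × X) (Fin r × X) ℂ), P.PosSemidef →
    (Matrix.of fun p q : Fin r × Y =>
      N (Matrix.of fun x x' => P (p.1, x) (q.1, x')) p.2 q.2).PosSemidef

/-- A quantum channel: a completely positive and trace-preserving linear map. -/
structure IsQuantumChannel {X Y : Type*} [Fintype X] [Fintype Y]
    (N : Matrix X X ℂ →ₗ[ℂ] Matrix Y Y ℂ) : Prop where
  completelyPositive : IsCompletelyPositive N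
  trace_preserving : ∀ ρ : Matrix X X ℂ, (N ρ).trace = ρ.trace

/-- The Choi matrix `∑ x x', |x⟩⟨x'| ⊗ N (|x⟩⟨x'|)`. -/
def choi {X Y : Type*} [DecidableEq X] (N : Matrix X X ℂ →ₗ[ℂ] Matrix Y Y ℂ) :
    Matrix (X × Y) (X × Y) ℂ :=
  Matrix.of fun p q => N (Matrix.single p.1 q.1 1) p.2 q.2

/-- The operator `ρ 0 ⊗ ⋯ ⊗ ρ (k - 1)` on the `k`-fold tensor power. -/
def tensorProd {X : Type*} {k : ℕ} (ρ : Fin k → Matrix X X ℂ) :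
    Matrix (Fin k → X) (Fin k → X) ℂ :=
  Matrix.of fun x x' => ∏ i, ρ i (x i) (x' i)

/-- The `k`-fold tensor power of a linear map, which sends each `|x⟩⟨x'|`, the tensor product of
the operators `|x i⟩⟨x' i|`, to the tensor product of their images. -/
def channelPow {X Y : Type*} [Fintype X] [DecidableEq X]
    (N : Matrix X X ℂ →ₗ[ℂ] Matrix Y Y ℂ) (k : ℕ) :
    Matrix (Fin k → X) (Fin k → X) ℂ →ₗ[ℂ] Matrix (Fin k → Y) (Fin k → Y) ℂ where
  toFun ρ := ∑ x, ∑ x', ρ x x' • tensorProd fun i => N (Matrix.single (x i) (x' i) 1)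
  map_add' ρ σ := by
    simp only [Matrix.add_apply, add_smul, Finset.sum_add_distrib]
  map_smul' c ρ := by
    simp only [Matrix.smul_apply, smul_eq_mul, mul_smul, Finset.smul_sum, RingHom.id_apply]

/-- The permutation matrix on the `k`-fold tensor power for the action
`π • (h 0 ⊗ ⋯ ⊗ h (k - 1)) = h (π⁻¹ 0) ⊗ ⋯ ⊗ h (π⁻¹ (k - 1))`. -/
def permOp (X : Type*) [DecidableEq X] {k : ℕ} (π : Equiv.Perm (Fin k)) :
    Matrix (Fin k → X) (Fin k → X) ℂ :=
  Matrix.of fun x x' => if x = x' ∘ ⇑π⁻¹ then 1 else 0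

/-- Permutation-invariant operators on the `k`-fold tensor power of one space. -/
def IsPermInvariant {Y : Type*} [Fintype Y] [DecidableEq Y] {k : ℕ}
    (T : Matrix (Fin k → Y) (Fin k → Y) ℂ) : Prop :=
  ∀ π : Equiv.Perm (Fin k), T * permOp Y π = permOp Y π * T

/-- Permutation-invariant operators on the product of the `k`-fold tensor powers of two spaces,
for the simultaneous action on both factors. -/
def IsPermInvariantPair {X Y : Type*} [Fintype X] [DecidableEq X] [Fintype Y] [DecidableEq Y]
    {k : ℕ} (T : Matrix ((Fin k → X) × (Fin k → Y)) ((Fin k → X) × (Fin k → Y)) ℂ) : Prop :=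
  ∀ π : Equiv.Perm (Fin k),
    T * (permOp X π ⊗ₖ permOp Y π) = (permOp X π ⊗ₖ permOp Y π) * T

/-- The constraints of the convex program; `J` is the Choi matrix of the completely positive
map over which one optimizes. -/
structure UpsilonFeasible {X Y : Type*} [Fintype X] [DecidableEq X] [Fintype Y] [DecidableEq Y]
    (α : ℝ) (N : Matrix X X ℂ →ₗ[ℂ] Matrix Y Y ℂ) (k : ℕ)
    (A R J : Matrix ((Fin k → X) × (Fin k → Y)) ((Fin k → X) × (Fin k → Y)) ℂ)
    (S : Matrix (Fin k → Y) (Fin k → Y) ℂ) : Prop where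
  posSemidef_A : A.PosSemidef
  posSemidef_R : R.PosSemidef
  posSemidef_J : J.PosSemidef
  posSemidef_S : S.PosSemidef
  choi_le : LoewnerLE (choi (channelPow N k)) (geomMean (1 / α) J A)
  R_add : (R + partialTransposeRight J).PosSemidef
  R_sub : (R - partialTransposeRight J).PosSemidef
  S_add : ((1 : Matrix (Fin k → X) (Fin k → X) ℂ) ⊗ₖ S + partialTransposeRight R).PosSemidef
  S_sub : ((1 : Matrix (Fin k → X) (Fin k → X) ℂ) ⊗ₖ S - partialTransposeRight R).PosSemidef
  trace_S : S.trace.re ≤ 1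

/-- An optimal solution: a feasible point at which `‖tr_Y A‖`, and therefore the program's value
`(1 / (α - 1)) log ‖tr_Y A‖`, is the least over all feasible points. -/
structure UpsilonOptimal {X Y : Type*} [Fintype X] [DecidableEq X] [Fintype Y] [DecidableEq Y]
    (α : ℝ) (N : Matrix X X ℂ →ₗ[ℂ] Matrix Y Y ℂ) (k : ℕ)
    (A R J : Matrix ((Fin k → X) × (Fin k → Y)) ((Fin k → X) × (Fin k → Y)) ℂ)
    (S : Matrix (Fin k → Y) (Fin k → Y) ℂ) : Prop where
  feasible : UpsilonFeasible α N k A R J S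
  le_of_feasible : ∀ A' R' J' S', UpsilonFeasible α N k A' R' J' S' →
    opNorm (partialTraceRight A) ≤ opNorm (partialTraceRight A')

end

/-! ### Real powers and simultaneous diagonalization -/

/-! The program is convex and symmetric under permutations of the tensor factors, so averaging an
optimal point over the group gives an invariant one. The work lies in the geometric mean constraint,
the only nonlinear one, and in the existence of an optimum.

Joint concavity of the mean is homogeneity (`posGeomMean_smul`) plus superadditivity
(`posSemidef_posGeomMean_add_sub`). For the latter, `x ^ β` is an integral over `t` of positive
multiples of `x / (t + x)`. After simultaneous diagonalization each integrand is a multiple of a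
parallel sum, whose quadratic form at `v` is the minimum over `u` of `P[v - u] + t⁻¹ Q[u]`. The `u`
that is optimal for the summed pair may be used for both summands. Superadditivity implies
monotonicity, so the regularized means decrease as `ε` does; their limit exists, and lying below it
means lying below all of them (`loewnerLE_geomMean_iff`). In this form the constraint is seen to be
convex, closed and permutation invariant, without any continuity of the mean at singular matrices.

The trace bound on `S` controls `R`, which controls `J`, and the objective controls `A`, so sublevel
sets are compact; suitable multiples of the Choi matrix and the identity give a feasible point. The
Choi matrix of the tensor power is permutation invariant, and the operator norm is convex and does
not grow under relabelling, so the average of an optimum is feasible and optimal. -/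

theorem Matrix.IsHermitian.matPow_eq {n : Type*} [Fintype n] [DecidableEq n] {A : Matrix n n ℂ}
    (hA : A.IsHermitian) (s : ℝ) :
    matPow A s = (hA.eigenvectorUnitary : Matrix n n ℂ) *
      Matrix.diagonal (fun i => ((hA.eigenvalues i ^ s : ℝ) : ℂ)) *
      (hA.eigenvectorUnitary : Matrix n n ℂ)ᴴ := by
  rw [matPow, hA.cfc_eq, Matrix.IsHermitian.cfc, Unitary.conjStarAlgAut_apply]
  rfl

theorem Matrix.IsHermitian.matPow {n : Type*} [Fintype n] [DecidableEq n] {A : Matrix n n ℂ}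
    (hA : A.IsHermitian) (s : ℝ) : (matPow A s).IsHermitian := by
  rw [hA.matPow_eq]
  refine Matrix.isHermitian_mul_mul_conjTranspose _ ?_
  exact Matrix.isHermitian_diagonal_of_self_adjoint _ (by ext i; simp)

theorem Matrix.eigenvectorUnitary_conjTranspose_mul {n : Type*} [Fintype n] [DecidableEq n]
    {A : Matrix n n ℂ} (hA : A.IsHermitian) :
    (hA.eigenvectorUnitary : Matrix n n ℂ)ᴴ * (hA.eigenvectorUnitary : Matrix n n ℂ) = 1 :=
  Unitary.coe_star_mul_self hA.eigenvectorUnitary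

theorem Matrix.eigenvectorUnitary_mul_conjTranspose {n : Type*} [Fintype n] [DecidableEq n]
    {A : Matrix n n ℂ} (hA : A.IsHermitian) :
    (hA.eigenvectorUnitary : Matrix n n ℂ) * (hA.eigenvectorUnitary : Matrix n n ℂ)ᴴ = 1 :=
  Unitary.coe_mul_star_self hA.eigenvectorUnitary

theorem Matrix.PosDef.matPow_mul_matPow {n : Type*} [Fintype n] [DecidableEq n]
    {A : Matrix n n ℂ} (hA : A.PosDef) (s t : ℝ) :
    matPow A s * matPow A t = matPow A (s + t) := by
  have hH := hA.isHermitian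
  have hU := Matrix.eigenvectorUnitary_conjTranspose_mul hH
  rw [hH.matPow_eq, hH.matPow_eq, hH.matPow_eq]
  set U : Matrix n n ℂ := (hH.eigenvectorUnitary : Matrix n n ℂ)
  set D : ℝ → Matrix n n ℂ :=
    fun s => Matrix.diagonal (fun i => ((hH.eigenvalues i ^ s : ℝ) : ℂ)) with hD
  have hDD : D s * D t = D (s + t) := by
    simp only [hD, Matrix.diagonal_mul_diagonal]
    congr 1
    ext i
    rw [← Complex.ofReal_mul, Real.rpow_add (hA.eigenvalues_pos i)]
  calc U * D s * Uᴴ * (U * D t * Uᴴ) = U * D s * (Uᴴ * U) * D t * Uᴴ := by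
        simp only [Matrix.mul_assoc]
    _ = U * D (s + t) * Uᴴ := by rw [hU, Matrix.mul_one, Matrix.mul_assoc U, hDD]

theorem Matrix.IsHermitian.matPow_one {n : Type*} [Fintype n] [DecidableEq n] {A : Matrix n n ℂ}
    (hA : A.IsHermitian) : _root_.matPow A 1 = A := by
  rw [hA.matPow_eq]
  conv_rhs => rw [hA.spectral_theorem, Unitary.conjStarAlgAut_apply]
  simp only [Real.rpow_one]
  rfl

theorem Matrix.IsHermitian.matPow_zero {n : Type*} [Fintype n] [DecidableEq n]
    {A : Matrix n n ℂ} (hA : A.IsHermitian) : _root_.matPow A 0 = 1 := by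
  rw [hA.matPow_eq]
  simp only [Real.rpow_zero, Complex.ofReal_one, Matrix.diagonal_one, Matrix.mul_one]
  exact Matrix.eigenvectorUnitary_mul_conjTranspose hA

/-- Two positive definite matrices are simultaneously diagonalizable by a congruence, and the
geometric mean is read off from the diagonal form. -/
theorem exists_simultaneous_diagonalization {n : Type*} [Fintype n] [DecidableEq n]
    {P Q : Matrix n n ℂ} (hP : P.PosDef) (hQ : Q.PosDef) (β : ℝ) :
    ∃ (T B : Matrix n n ℂ) (d : n → ℝ), (∀ i, 0 < d i) ∧ T * B = 1 ∧
      P = Tᴴ * Matrix.diagonal (fun _ => ((1 : ℝ) : ℂ)) * T ∧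
      Q = Tᴴ * Matrix.diagonal (fun i => (d i : ℂ)) * T ∧
      posGeomMean β P Q = Tᴴ * Matrix.diagonal (fun i => ((d i ^ β : ℝ) : ℂ)) * T := by
  set H := matPow P (1 / 2) with hH
  set K := matPow P (-(1 / 2)) with hK
  have hHh : Hᴴ = H := hP.isHermitian.matPow _
  have hKh : Kᴴ = K := hP.isHermitian.matPow _
  have hHK : H * K = 1 := by
    rw [hH, hK, hP.matPow_mul_matPow, add_neg_cancel, hP.isHermitian.matPow_zero]
  have hKH : K * H = 1 := by
    rw [hH, hK, hP.matPow_mul_matPow, neg_add_cancel, hP.isHermitian.matPow_zero]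
  have hHH : H * H = P := by
    rw [hH, hP.matPow_mul_matPow, add_halves, hP.isHermitian.matPow_one]
  have hX : (K * Q * K).PosDef := by
    have h := hQ.conjTranspose_mul_mul_same (B := K) ?_
    · rwa [hKh] at h
    · intro v w hvw
      have := congrArg (fun z => H *ᵥ z) hvw
      simpa [Matrix.mulVec_mulVec, hHK] using this
  have hXh := hX.isHermitian
  have hU := Matrix.eigenvectorUnitary_conjTranspose_mul hXh
  have hU' := Matrix.eigenvectorUnitary_mul_conjTranspose hXh
  have hpow := hXh.matPow_eq
  set U : Matrix n n ℂ := (hXh.eigenvectorUnitary : Matrix n n ℂ)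
  have hT : (Uᴴ * H)ᴴ = H * U := by
    rw [Matrix.conjTranspose_mul, Matrix.conjTranspose_conjTranspose, hHh]
  -- The exponents `0`, `1` and `β` give the diagonal forms of `P`, of `Q` and of their mean, all
  -- with the same congruence.
  have key : ∀ s : ℝ, H * matPow (K * Q * K) s * H = (Uᴴ * H)ᴴ *
      Matrix.diagonal (fun i => ((hXh.eigenvalues i ^ s : ℝ) : ℂ)) * (Uᴴ * H) := by
    intro s
    rw [hpow, hT]
    simp only [Matrix.mul_assoc]
  refine ⟨Uᴴ * H, K * U, hXh.eigenvalues, hX.eigenvalues_pos, ?_, ?_, ?_, ?_⟩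
  · rw [Matrix.mul_assoc, ← Matrix.mul_assoc H, hHK, Matrix.one_mul, hU]
  · have := key 0
    simp only [Real.rpow_zero, hXh.matPow_zero, Matrix.mul_one, hHH] at this
    exact this
  · have := key 1
    simp only [Real.rpow_one, hXh.matPow_one] at this
    rw [← this]
    calc Q = (H * K) * Q * (K * H) := by rw [hHK, hKH, Matrix.one_mul, Matrix.mul_one]
      _ = _ := by simp only [Matrix.mul_assoc]
  · exact key β

/-! ### The quadratic form of the geometric mean -/

/-- The real quadratic form of a matrix. -/
noncomputable def reQuad {n : Type*} [Fintype n] (M : Matrix n n ℂ) (v : n → ℂ) : ℝ :=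
  (star v ⬝ᵥ M *ᵥ v).re

theorem reQuad_add {n : Type*} [Fintype n] (M N : Matrix n n ℂ) (v : n → ℂ) :
    reQuad (M + N) v = reQuad M v + reQuad N v := by
  simp [reQuad, Matrix.add_mulVec]

theorem reQuad_sub {n : Type*} [Fintype n] (M N : Matrix n n ℂ) (v : n → ℂ) :
    reQuad (M - N) v = reQuad M v - reQuad N v := by
  simp [reQuad, Matrix.sub_mulVec]

theorem Matrix.PosSemidef.reQuad_nonneg {n : Type*} [Fintype n] {M : Matrix n n ℂ}
    (hM : M.PosSemidef) (v : n → ℂ) : 0 ≤ reQuad M v :=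
  (Complex.le_def.mp (hM.dotProduct_mulVec_nonneg v)).1

theorem Matrix.IsHermitian.posSemidef_of_reQuad {n : Type*} [Fintype n] {M : Matrix n n ℂ}
    (hM : M.IsHermitian) (h : ∀ v, 0 ≤ reQuad M v) : M.PosSemidef := by
  refine Matrix.PosSemidef.of_dotProduct_mulVec_nonneg hM fun v => ?_
  rw [Complex.le_def]
  exact ⟨h v, (hM.im_star_dotProduct_mulVec_self v).symm⟩

theorem reQuad_conjTranspose_diagonal {n : Type*} [Fintype n] [DecidableEq n]
    (T : Matrix n n ℂ) (d : n → ℝ) (v : n → ℂ) :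
    reQuad (Tᴴ * Matrix.diagonal (fun i => (d i : ℂ)) * T) v =
      ∑ i, d i * ‖(T *ᵥ v) i‖ ^ 2 := by
  have : star v ⬝ᵥ (Tᴴ * Matrix.diagonal (fun i => (d i : ℂ)) * T) *ᵥ v =
      star (T *ᵥ v) ⬝ᵥ (Matrix.diagonal (fun i => (d i : ℂ)) *ᵥ (T *ᵥ v)) := by
    rw [Matrix.star_mulVec, ← Matrix.mulVec_mulVec, ← Matrix.mulVec_mulVec,
      Matrix.dotProduct_mulVec, Matrix.dotProduct_mulVec, Matrix.dotProduct_mulVec]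
  rw [reQuad, this, dotProduct, Complex.re_sum]
  refine Finset.sum_congr rfl fun i _ => ?_
  rw [Matrix.mulVec_diagonal, ← Complex.normSq_eq_norm_sq, Complex.normSq_apply]
  simp
  ring

/-- The parallel sum of a one-dimensional form with weight `1` and one with weight `d / t`. -/
theorem div_add_mul_norm_sq_le {d t : ℝ} (hd : 0 < d) (ht : 0 < t) (w u : ℂ) :
    d / (t + d) * ‖w‖ ^ 2 ≤ ‖w - u‖ ^ 2 + t⁻¹ * (d * ‖u‖ ^ 2) := by
  have h : 0 < t + d := by positivity
  -- Completing the square in `u`.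
  have key : ‖w - u‖ ^ 2 + t⁻¹ * (d * ‖u‖ ^ 2) - d / (t + d) * ‖w‖ ^ 2 =
      (t + d) / t * ‖u - ((t / (t + d) : ℝ) : ℂ) * w‖ ^ 2 := by
    simp only [← Complex.normSq_eq_norm_sq, Complex.normSq_apply, Complex.sub_re, Complex.sub_im,
      Complex.mul_re, Complex.mul_im, Complex.ofReal_re, Complex.ofReal_im]
    field_simp
    ring
  have : 0 ≤ (t + d) / t * ‖u - ((t / (t + d) : ℝ) : ℂ) * w‖ ^ 2 := by positivity
  linarith

/-- The equality case of the previous bound: the square that was dropped vanishes at `u = t / (t +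
d) * w`. -/
theorem div_add_mul_norm_sq_eq {d t : ℝ} (hd : 0 < d) (ht : 0 < t) (w : ℂ) :
    d / (t + d) * ‖w‖ ^ 2 = ‖w - ((t / (t + d) : ℝ) : ℂ) * w‖ ^ 2 +
      t⁻¹ * (d * ‖((t / (t + d) : ℝ) : ℂ) * w‖ ^ 2) := by
  have h : 0 < t + d := by positivity
  simp only [← Complex.normSq_eq_norm_sq, Complex.normSq_apply, Complex.sub_re, Complex.sub_im,
      Complex.mul_re, Complex.mul_im, Complex.ofReal_re, Complex.ofReal_im]
  field_simp
  ring

/-- The geometric mean of positive definite matrices is superadditive in each quadratic form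
because it is an integral of parallel sums, which are infima of sums of quadratic forms. -/
theorem posSemidef_posGeomMean_add_sub {n : Type*} [Fintype n] [DecidableEq n] {β : ℝ}
    (hβ : β ∈ Set.Ioo (0 : ℝ) 1) {P₁ Q₁ P₂ Q₂ : Matrix n n ℂ} (hP₁ : P₁.PosDef)
    (hQ₁ : Q₁.PosDef) (hP₂ : P₂.PosDef) (hQ₂ : Q₂.PosDef) :
    (posGeomMean β (P₁ + P₂) (Q₁ + Q₂) -
      (posGeomMean β P₁ Q₁ + posGeomMean β P₂ Q₂)).PosSemidef := by
  obtain ⟨T₁, -, d₁, hd₁, -, eP₁, eQ₁, eM₁⟩ := exists_simultaneous_diagonalization hP₁ hQ₁ β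
  obtain ⟨T₂, -, d₂, hd₂, -, eP₂, eQ₂, eM₂⟩ := exists_simultaneous_diagonalization hP₂ hQ₂ β
  obtain ⟨T, B, d, hd, hTB, eP, eQ, eM⟩ :=
    exists_simultaneous_diagonalization (hP₁.add hP₂) (hQ₁.add hQ₂) β
  have herm : ∀ (T : Matrix n n ℂ) (d : n → ℝ),
      (Tᴴ * Matrix.diagonal (fun i => (d i : ℂ)) * T).IsHermitian := fun T d =>
    Matrix.isHermitian_conjTranspose_mul_mul _
      (Matrix.isHermitian_diagonal_of_self_adjoint _ (by ext i; simp))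
  refine Matrix.IsHermitian.posSemidef_of_reQuad ?_ fun v => ?_
  · rw [eM₁, eM₂, eM]
    exact (herm _ _).sub ((herm _ _).add (herm _ _))
  rw [reQuad_sub, reQuad_add, sub_nonneg, eM₁, eM₂, eM]
  simp only [reQuad_conjTranspose_diagonal]
  obtain ⟨μ, hμ⟩ := Real.exists_measure_rpow_eq_integral_rpowIntegrand₀₁ hβ
  have hint : ∀ (d : n → ℝ) (w : n → ℂ), (∀ i, 0 < d i) →
      MeasureTheory.IntegrableOn
        (fun t => ∑ i, Real.rpowIntegrand₀₁ β t (d i) * ‖w i‖ ^ 2) (Set.Ioi 0) μ ∧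
      ∑ i, d i ^ β * ‖w i‖ ^ 2 =
        ∫ t in Set.Ioi 0, ∑ i, Real.rpowIntegrand₀₁ β t (d i) * ‖w i‖ ^ 2 ∂μ := by
    intro d w hd
    have hi : ∀ i ∈ Finset.univ, MeasureTheory.IntegrableOn
        (fun t => Real.rpowIntegrand₀₁ β t (d i) * ‖w i‖ ^ 2) (Set.Ioi 0) μ := fun i _ =>
      (hμ (d i) (hd i).le).1.mul_const _
    refine ⟨MeasureTheory.integrable_finsetSum _ hi, ?_⟩
    rw [MeasureTheory.integral_finsetSum _ hi]
    refine Finset.sum_congr rfl fun i _ => ?_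
    rw [(hμ (d i) (hd i).le).2, MeasureTheory.integral_mul_const]
  obtain ⟨i₁, e₁⟩ := hint d₁ (T₁ *ᵥ v) hd₁
  obtain ⟨i₂, e₂⟩ := hint d₂ (T₂ *ᵥ v) hd₂
  obtain ⟨i₀, e₀⟩ := hint d (T *ᵥ v) hd
  rw [e₁, e₂, e₀, ← MeasureTheory.integral_add i₁ i₂]
  refine MeasureTheory.setIntegral_mono_on (i₁.add i₂) i₀ measurableSet_Ioi fun t ht => ?_
  have ht : 0 < t := ht
  have hform : ∀ (x : ℝ), 0 < x → Real.rpowIntegrand₀₁ β t x = t ^ (β - 1) * (x / (t + x)) := by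
    intro x hx
    rw [Real.rpowIntegrand₀₁_eq_pow_div hβ ht.le hx.le]
    ring
  have hsum : ∀ (d : n → ℝ) (w : n → ℂ), (∀ i, 0 < d i) →
      ∑ i, Real.rpowIntegrand₀₁ β t (d i) * ‖w i‖ ^ 2 =
        t ^ (β - 1) * ∑ i, d i / (t + d i) * ‖w i‖ ^ 2 := by
    intro d w hd
    rw [Finset.mul_sum]
    refine Finset.sum_congr rfl fun i _ => ?_
    rw [hform _ (hd i)]
    ring
  rw [hsum _ _ hd₁, hsum _ _ hd₂, hsum _ _ hd, ← mul_add]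
  refine mul_le_mul_of_nonneg_left ?_ (by positivity)
  -- The minimizer for the summed pair, coordinatewise in its diagonalizing basis; the right inverse
  -- `B` carries it back.
  set u : n → ℂ := B *ᵥ fun i => ((t / (t + d i) : ℝ) : ℂ) * (T *ᵥ v) i with hu
  have hTu : T *ᵥ u = fun i => ((t / (t + d i) : ℝ) : ℂ) * (T *ᵥ v) i := by
    rw [hu, Matrix.mulVec_mulVec, hTB, Matrix.one_mulVec]
  -- Any `u` bounds the parallel sum of any pair from above, so this one serves both summands.
  have hle : ∀ (S P Q : Matrix n n ℂ) (c : n → ℝ), (∀ i, 0 < c i) →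
      P = Sᴴ * Matrix.diagonal (fun _ => ((1 : ℝ) : ℂ)) * S →
      Q = Sᴴ * Matrix.diagonal (fun i => (c i : ℂ)) * S →
      ∑ i, c i / (t + c i) * ‖(S *ᵥ v) i‖ ^ 2 ≤ reQuad P (v - u) + t⁻¹ * reQuad Q u := by
    intro S P Q c hc hP hQ
    rw [hP, hQ, reQuad_conjTranspose_diagonal, reQuad_conjTranspose_diagonal, Finset.mul_sum,
      ← Finset.sum_add_distrib]
    refine Finset.sum_le_sum fun i _ => ?_
    rw [Matrix.mulVec_sub, Pi.sub_apply, one_mul]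
    exact div_add_mul_norm_sq_le (hc i) ht _ _
  have heq : ∑ i, d i / (t + d i) * ‖(T *ᵥ v) i‖ ^ 2 =
      reQuad (P₁ + P₂) (v - u) + t⁻¹ * reQuad (Q₁ + Q₂) u := by
    rw [eP, eQ, reQuad_conjTranspose_diagonal, reQuad_conjTranspose_diagonal, Finset.mul_sum,
      ← Finset.sum_add_distrib]
    refine Finset.sum_congr rfl fun i _ => ?_
    rw [Matrix.mulVec_sub, Pi.sub_apply, one_mul, hTu]
    exact div_add_mul_norm_sq_eq (hd i) ht _
  rw [heq, reQuad_add, reQuad_add]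
  have h₁ := hle T₁ P₁ Q₁ d₁ hd₁ eP₁ eQ₁
  have h₂ := hle T₂ P₂ Q₂ d₂ hd₂ eP₂ eQ₂
  linarith

theorem posSemidef_posGeomMean {n : Type*} [Fintype n] [DecidableEq n] {P Q : Matrix n n ℂ}
    (hP : P.PosDef) (hQ : Q.PosDef) (β : ℝ) : (posGeomMean β P Q).PosSemidef := by
  obtain ⟨T, -, d, hd, -, -, -, e⟩ := exists_simultaneous_diagonalization hP hQ β
  rw [e]
  refine Matrix.PosSemidef.conjTranspose_mul_mul_same (Matrix.PosSemidef.diagonal fun i => ?_) T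
  exact Complex.zero_le_real.mpr (Real.rpow_nonneg (hd i).le β)

/-- The commuting case, in which the mean is explicit; it supplies the feasible point of the
program. -/
theorem posGeomMean_smul_self {n : Type*} [Fintype n] [DecidableEq n] {P : Matrix n n ℂ}
    (hP : P.PosDef) (c β : ℝ) : posGeomMean β P (c • P) = (c ^ β) • P := by
  have h0 : matPow P (-(1 / 2)) * P * matPow P (-(1 / 2)) = 1 := by
    conv_lhs =>
      enter [1, 2]
      rw [← hP.isHermitian.matPow_one]
    rw [hP.matPow_mul_matPow, hP.matPow_mul_matPow]
    norm_num [hP.isHermitian.matPow_zero]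
  have h1 : matPow P (-(1 / 2)) * (c • P) * matPow P (-(1 / 2)) =
      algebraMap ℝ (Matrix n n ℂ) c := by
    rw [Algebra.algebraMap_eq_smul_one, Matrix.mul_smul, Matrix.smul_mul, h0]
  have h2 : matPow (algebraMap ℝ (Matrix n n ℂ) c) β = algebraMap ℝ (Matrix n n ℂ) (c ^ β) :=
    cfc_algebraMap c fun x : ℝ => x ^ β
  rw [posGeomMean, h1, h2, Algebra.algebraMap_eq_smul_one, Matrix.mul_smul, Matrix.smul_mul,
    Matrix.mul_one, hP.matPow_mul_matPow, add_halves, hP.isHermitian.matPow_one]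

/-- Functional calculus on a finite spectrum, where every function is continuous; positivity of the
eigenvalues makes the real power multiplicative. -/
theorem Matrix.PosDef.matPow_smul {n : Type*} [Fintype n] [DecidableEq n] {P : Matrix n n ℂ}
    (hP : P.PosDef) {c : ℝ} (hc : 0 < c) (s : ℝ) :
    _root_.matPow (c • P) s = (c ^ s) • _root_.matPow P s := by
  have hs : IsSelfAdjoint P := hP.isHermitian
  have hfin : ∀ f : ℝ → ℝ, ContinuousOn f (spectrum ℝ P) := fun f =>
    Matrix.finite_real_spectrum.continuousOn f
  have hfin' : ∀ f : ℝ → ℝ, ContinuousOn f ((c * ·) '' spectrum ℝ P) := fun f =>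
    (Matrix.finite_real_spectrum.image _).continuousOn f
  rw [_root_.matPow, _root_.matPow, ← cfc_comp_const_mul c (fun x : ℝ => x ^ s) P (hfin' _) hs,
    ← cfc_smul (c ^ s) (fun x : ℝ => x ^ s) P (hfin _)]
  refine cfc_congr fun x hx => ?_
  rw [hP.isHermitian.spectrum_real_eq_range_eigenvalues] at hx
  obtain ⟨i, rfl⟩ := hx
  exact Real.mul_rpow hc.le (hP.eigenvalues_pos i).le

theorem posGeomMean_smul {n : Type*} [Fintype n] [DecidableEq n] {P : Matrix n n ℂ}
    (hP : P.PosDef) (Q : Matrix n n ℂ) {c : ℝ} (hc : 0 < c) (β : ℝ) :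
    posGeomMean β (c • P) (c • Q) = c • posGeomMean β P Q := by
  have h1 : c * c ^ (-(1 / 2) : ℝ) * c ^ (-(1 / 2) : ℝ) = 1 := by
    rw [mul_assoc, ← Real.rpow_add hc]
    norm_num [Real.rpow_neg_one, hc.ne']
  have h2 : c ^ (1 / 2 : ℝ) * c ^ (1 / 2 : ℝ) = c := by
    rw [← Real.rpow_add hc]
    norm_num
  have hX : matPow (c • P) (-(1 / 2)) * (c • Q) * matPow (c • P) (-(1 / 2)) =
      matPow P (-(1 / 2)) * Q * matPow P (-(1 / 2)) := by
    simp only [hP.matPow_smul hc, Matrix.smul_mul, Matrix.mul_smul, smul_smul]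
    convert one_smul ℝ _ using 2
    linarith [h1]
  rw [posGeomMean, hX, hP.matPow_smul hc, Matrix.smul_mul, Matrix.smul_mul, Matrix.mul_smul,
    smul_smul, h2, posGeomMean]

/-! ### Relabelling of the basis -/

/-- Relabelling the basis by an equivalence is a star algebra homomorphism. -/
def submatrixStarAlgHom {m n : Type*} [Fintype m] [DecidableEq m] [Fintype n] [DecidableEq n]
    (e : m ≃ n) : Matrix n n ℂ →⋆ₐ[ℂ] Matrix m m ℂ where
  toFun M := M.submatrix e e
  map_one' := Matrix.submatrix_one_equiv e
  map_mul' M N := (Matrix.submatrix_mul_equiv M N e e e).symm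
  map_zero' := rfl
  map_add' _ _ := rfl
  commutes' r := by
    rw [Algebra.algebraMap_eq_smul_one, Algebra.algebraMap_eq_smul_one, Matrix.submatrix_smul,
      Pi.smul_apply, Pi.smul_apply, Matrix.submatrix_one_equiv]
  map_star' _ := rfl

/-- Star homomorphisms commute with the functional calculus. -/
theorem matPow_submatrix {m n : Type*} [Fintype m] [DecidableEq m] [Fintype n] [DecidableEq n]
    (e : m ≃ n) {A : Matrix n n ℂ} (hA : A.IsHermitian) (s : ℝ) :
    matPow (A.submatrix e e) s = (matPow A s).submatrix e e :=
  ((submatrixStarAlgHom e).map_cfc (fun x : ℝ => x ^ s) A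
    (Matrix.finite_real_spectrum.continuousOn _)
    (by exact Continuous.matrix_submatrix continuous_id e e) hA (hA.submatrix e)).symm

theorem posGeomMean_submatrix {m n : Type*} [Fintype m] [DecidableEq m] [Fintype n]
    [DecidableEq n] (e : m ≃ n) {P Q : Matrix n n ℂ} (hP : P.IsHermitian) (hQ : Q.IsHermitian)
    (β : ℝ) : posGeomMean β (P.submatrix e e) (Q.submatrix e e) =
      (posGeomMean β P Q).submatrix e e := by
  have hK := hP.matPow (-(1 / 2))
  have hX : (matPow P (-(1 / 2)) * Q * matPow P (-(1 / 2))).IsHermitian := by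
    have := Matrix.isHermitian_conjTranspose_mul_mul (matPow P (-(1 / 2))) hQ
    rwa [hK.eq] at this
  simp only [posGeomMean, matPow_submatrix e hP, Matrix.submatrix_mul_equiv, matPow_submatrix e hX]

section LoewnerOrder

open scoped MatrixOrder Matrix.Norms.L2Operator

/-! ### Positive semidefinite matrices and the Loewner order -/

theorem isClosed_posSemidef {n : Type*} [Fintype n] :
    IsClosed {M : Matrix n n ℂ | M.PosSemidef} := by
  have : {M : Matrix n n ℂ | M.PosSemidef} =
      {M | Mᴴ = M} ∩ ⋂ v : n → ℂ, {M | 0 ≤ reQuad M v} := by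
    ext M
    simp only [Set.mem_ofPred_eq, Set.mem_inter_iff, Set.mem_iInter]
    exact ⟨fun h => ⟨h.isHermitian, h.reQuad_nonneg⟩,
      fun h => Matrix.IsHermitian.posSemidef_of_reQuad h.1 h.2⟩
  rw [this]
  refine (isClosed_eq (by fun_prop) continuous_id).inter
    (isClosed_iInter fun v => isClosed_le continuous_const ?_)
  unfold reQuad
  fun_prop

/-- Writing `M = B* B`, each entry is an inner product of columns of `B`, while the trace is the sum
of all `‖B r l‖ ^ 2`; the arithmetic-geometric mean inequality compares them row by row. -/
theorem Matrix.PosSemidef.norm_apply_le_trace {n : Type*} [Fintype n] {M : Matrix n n ℂ}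
    (hM : M.PosSemidef) (i j : n) : ‖M i j‖ ≤ M.trace.re := by
  classical
  obtain ⟨B, rfl⟩ := Matrix.nonneg_iff_posSemidef.mpr hM |> CStarAlgebra.nonneg_iff_eq_star_mul_self.mp
  have htr : (star B * B).trace.re = ∑ r, ∑ l, ‖B r l‖ ^ 2 := by
    simp only [Matrix.trace, Matrix.diag, Matrix.mul_apply, Matrix.star_apply, Complex.re_sum]
    rw [Finset.sum_comm]
    refine Finset.sum_congr rfl fun r _ => Finset.sum_congr rfl fun l _ => ?_
    rw [← Complex.normSq_eq_norm_sq, Complex.normSq_apply]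
    simp
  rw [htr, Matrix.mul_apply]
  refine (norm_sum_le _ _).trans (Finset.sum_le_sum fun r _ => ?_)
  rw [Matrix.star_apply, norm_mul, norm_star]
  have h : ∀ l, ‖B r l‖ ^ 2 ≤ ∑ l, ‖B r l‖ ^ 2 := fun l =>
    Finset.single_le_sum (f := fun l => ‖B r l‖ ^ 2) (fun _ _ => by positivity)
      (Finset.mem_univ l)
  nlinarith [h i, h j, sq_nonneg (‖B r i‖ - ‖B r j‖)]

/-- If `A ± B` are positive semidefinite, the trace of `A` bounds the entries of `B`. -/
theorem norm_apply_le_trace_of_add_sub {n : Type*} [Fintype n] {A B : Matrix n n ℂ}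
    (hadd : (A + B).PosSemidef) (hsub : (A - B).PosSemidef) (i j : n) :
    ‖B i j‖ ≤ A.trace.re := by
  have h1 := hadd.norm_apply_le_trace i j
  have h2 := hsub.norm_apply_le_trace i j
  rw [Matrix.trace_add, Complex.add_re, Matrix.add_apply] at h1
  rw [Matrix.trace_sub, Complex.sub_re, Matrix.sub_apply] at h2
  have h3 : ‖(2 : ℂ) * B i j‖ ≤ ‖A i j + B i j‖ + ‖A i j - B i j‖ := by
    refine le_trans (le_of_eq ?_) (norm_sub_le _ _)
    congr 1
    ring
  rw [norm_mul, Complex.norm_ofNat] at h3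
  linarith

theorem Matrix.PosSemidef.posDef_add_smul_one {n : Type*} [Fintype n] [DecidableEq n]
    {M : Matrix n n ℂ} (hM : M.PosSemidef) {ε : ℝ} (hε : 0 < ε) :
    (M + (ε : ℂ) • (1 : Matrix n n ℂ)).PosDef :=
  Matrix.PosDef.posSemidef_add hM (Matrix.PosDef.one.smul (Complex.zero_lt_real.mpr hε))

theorem posDef_smul_one {n : Type*} [Fintype n] [DecidableEq n] {ε : ℝ} (hε : 0 < ε) :
    ((ε : ℂ) • (1 : Matrix n n ℂ)).PosDef :=
  Matrix.PosDef.one.smul (Complex.zero_lt_real.mpr hε)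

/-- Turns closeness in norm into a strict Loewner inequality, as needed for closedness of the mean
constraint. -/
theorem posDef_of_norm_lt {n : Type*} [Fintype n] [DecidableEq n]
    {M : Matrix n n ℂ} (hM : M.IsHermitian) {ε : ℝ} (hε : ‖M‖ < ε) :
    (M + (ε : ℂ) • (1 : Matrix n n ℂ)).PosDef := by
  have h1 : (M + (‖M‖ : ℂ) • (1 : Matrix n n ℂ)).PosSemidef := by
    have h := IsSelfAdjoint.neg_algebraMap_norm_le_self (show IsSelfAdjoint M from hM)
    rw [Matrix.le_iff, sub_neg_eq_add, Algebra.algebraMap_eq_smul_one] at h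
    exact h
  have h2 := h1.posDef_add_smul_one (sub_pos.mpr hε)
  rwa [add_assoc, ← add_smul, ← Complex.ofReal_add, add_sub_cancel] at h2

/-- Upgrades convergence of all quadratic forms to convergence of the entries. -/
theorem polarization_apply {n : Type*} [Fintype n] [DecidableEq n] (M : Matrix n n ℂ) (i j : n) :
    M i j = (1 / 4 : ℂ) *
      ((star (Pi.single i 1 + Pi.single j 1) ⬝ᵥ M *ᵥ (Pi.single i 1 + Pi.single j 1)) -
        (star (Pi.single i 1 - Pi.single j 1) ⬝ᵥ M *ᵥ (Pi.single i 1 - Pi.single j 1)) -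
        Complex.I * (star (Pi.single i 1 + Complex.I • Pi.single j 1) ⬝ᵥ
          M *ᵥ (Pi.single i 1 + Complex.I • Pi.single j 1)) +
        Complex.I * (star (Pi.single i 1 - Complex.I • Pi.single j 1) ⬝ᵥ
          M *ᵥ (Pi.single i 1 - Complex.I • Pi.single j 1))) := by
  have hs : ∀ l : n, star (Pi.single l (1 : ℂ) : n → ℂ) = Pi.single l 1 := fun l => by
    rw [Pi.star_single, star_one]
  simp only [star_add, star_sub, star_smul, hs, Matrix.mulVec_add, Matrix.mulVec_sub,
    Matrix.mulVec_smul, add_dotProduct, sub_dotProduct, smul_dotProduct, dotProduct_add,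
    dotProduct_sub, dotProduct_smul, single_one_dotProduct, Matrix.mulVec_single_one, smul_eq_mul,
    Matrix.col_apply]
  simp only [Complex.star_def, Complex.conj_I]
  ring_nf
  simp only [Complex.I_sq]
  ring

/-- A family of positive semidefinite matrices that is monotone in a positive real parameter
converges as the parameter decreases to zero. -/
theorem exists_tendsto_of_monotoneOn {n : Type*} [Fintype n] [DecidableEq n]
    {F : ℝ → Matrix n n ℂ} (hF : ∀ ε, 0 < ε → (F ε).PosSemidef)
    (hmono : MonotoneOn F (Set.Ioi 0)) : ∃ L, Tendsto F (𝓝[>] 0) (𝓝 L) := by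
  have hquad : ∀ v : n → ℂ, ∃ l : ℂ,
      Tendsto (fun ε => star v ⬝ᵥ F ε *ᵥ v) (𝓝[>] 0) (𝓝 l) := by
    intro v
    have hm : MonotoneOn (fun ε => reQuad (F ε) v) (Set.Ioi 0) := fun a ha b hb hab => by
      have := (Matrix.le_iff.mp (hmono ha hb hab)).reQuad_nonneg v
      rwa [reQuad_sub, sub_nonneg] at this
    have hb : BddBelow ((fun ε => reQuad (F ε) v) '' Set.Ioi 0) := by
      refine ⟨0, ?_⟩
      rintro _ ⟨ε, hε, rfl⟩
      exact (hF ε hε).reQuad_nonneg v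
    -- A monotone real function bounded below has a limit from the right; the imaginary part of the
    -- form is zero.
    refine ⟨_, ((Complex.continuous_ofReal.tendsto _).comp (hm.tendsto_nhdsGT hb)).congr' ?_⟩
    filter_upwards [self_mem_nhdsWithin] with ε hε
    have him := (hF ε hε).isHermitian.im_star_dotProduct_mulVec_self v
    exact Complex.ext rfl him.symm
  choose l hl using hquad
  have hentry : ∀ i j, ∃ c : ℂ, Tendsto (fun ε => F ε i j) (𝓝[>] 0) (𝓝 c) := by
    intro i j
    simp_rw [polarization_apply (F _) i j]
    exact ⟨_, (((hl _).sub (hl _)).sub ((hl _).const_mul _)).add ((hl _).const_mul _)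
      |>.const_mul _⟩
  choose L hL using hentry
  exact ⟨Matrix.of L, tendsto_pi_nhds.mpr fun i => tendsto_pi_nhds.mpr fun j => hL i j⟩

/-! ### The geometric mean of positive semidefinite matrices -/

/-- Superadditivity applied to `P' = P + (P' - P)` and `Q' = Q + (Q' - Q)`: the mean of the
differences is positive semidefinite and may be dropped. -/
theorem posGeomMean_le_of_posDef_sub {n : Type*} [Fintype n] [DecidableEq n] {β : ℝ}
    (hβ : β ∈ Set.Ioo (0 : ℝ) 1) {P Q P' Q' : Matrix n n ℂ} (hP : P.PosDef) (hQ : Q.PosDef)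
    (hP' : (P' - P).PosDef) (hQ' : (Q' - Q).PosDef) :
    posGeomMean β P Q ≤ posGeomMean β P' Q' := by
  have h := posSemidef_posGeomMean_add_sub hβ hP hQ hP' hQ'
  rw [add_sub_cancel, add_sub_cancel] at h
  have h' := posSemidef_posGeomMean hP' hQ' β
  have := h.add h'
  rwa [← sub_sub, sub_add_cancel] at this

/-- `C` lies below the geometric means of all regularizations of `J` and `A`. -/
def LeRegularizedMean {n : Type*} [Fintype n] [DecidableEq n] (β : ℝ) (C J A : Matrix n n ℂ) :
    Prop :=
  ∀ ε : ℝ, 0 < ε →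
    C ≤ posGeomMean β (J + (ε : ℂ) • (1 : Matrix n n ℂ)) (A + (ε : ℂ) • (1 : Matrix n n ℂ))

theorem monotoneOn_posGeomMean_add_smul_one {n : Type*} [Fintype n] [DecidableEq n] {β : ℝ}
    (hβ : β ∈ Set.Ioo (0 : ℝ) 1) {J A : Matrix n n ℂ} (hJ : J.PosSemidef) (hA : A.PosSemidef) :
    MonotoneOn (fun ε : ℝ => posGeomMean β (J + (ε : ℂ) • (1 : Matrix n n ℂ))
      (A + (ε : ℂ) • (1 : Matrix n n ℂ))) (Set.Ioi 0) := by
  intro a ha b hb hab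
  rcases hab.eq_or_lt with rfl | hab
  · exact le_rfl
  have h : ∀ M : Matrix n n ℂ, (M + (b : ℂ) • (1 : Matrix n n ℂ) -
      (M + (a : ℂ) • (1 : Matrix n n ℂ))).PosDef := fun M => by
    rw [add_sub_add_left_eq_sub, ← sub_smul, ← Complex.ofReal_sub]
    exact posDef_smul_one (sub_pos.mpr hab)
  exact posGeomMean_le_of_posDef_sub hβ (hJ.posDef_add_smul_one ha) (hA.posDef_add_smul_one ha)
    (h J) (h A)

/-- Guarantees that the `limUnder` in `geomMean` is a genuine limit, not a default value. -/
theorem tendsto_geomMean {n : Type*} [Fintype n] [DecidableEq n] {β : ℝ}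
    (hβ : β ∈ Set.Ioo (0 : ℝ) 1) {J A : Matrix n n ℂ} (hJ : J.PosSemidef) (hA : A.PosSemidef) :
    Tendsto (fun ε : ℝ => posGeomMean β (J + (ε : ℂ) • (1 : Matrix n n ℂ))
      (A + (ε : ℂ) • (1 : Matrix n n ℂ))) (𝓝[>] 0) (𝓝 (geomMean β J A)) :=
  tendsto_nhds_limUnder <| exists_tendsto_of_monotoneOn
    (fun _ hε => posSemidef_posGeomMean (hJ.posDef_add_smul_one hε)
      (hA.posDef_add_smul_one hε) β)
    (monotoneOn_posGeomMean_add_smul_one hβ hJ hA)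

theorem loewnerLE_geomMean_iff {n : Type*} [Fintype n] [DecidableEq n] {β : ℝ}
    (hβ : β ∈ Set.Ioo (0 : ℝ) 1) {C J A : Matrix n n ℂ} (hJ : J.PosSemidef)
    (hA : A.PosSemidef) : LoewnerLE C (geomMean β J A) ↔ LeRegularizedMean β C J A := by
  have hlim := tendsto_geomMean hβ hJ hA
  constructor
  · intro h ε hε
    refine le_trans (show C ≤ geomMean β J A from h) ?_
    refine isClosed_posSemidef.mem_of_tendsto (hlim.const_sub _) ?_
    filter_upwards [Ioo_mem_nhdsGT hε] with δ hδ
    exact monotoneOn_posGeomMean_add_smul_one hβ hJ hA hδ.1 hε hδ.2.le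
  · intro h
    refine isClosed_posSemidef.mem_of_tendsto (hlim.sub_const _) ?_
    filter_upwards [self_mem_nhdsWithin] with δ hδ
    exact h δ hδ

/-- If a pair `q` of the set is within `ε / 2` of `p` in norm, then `q + ε / 2` lies below `p + ε`
in both components, and monotonicity transfers the bound from `q` to `p`. -/
theorem isClosed_leRegularizedMean {n : Type*} [Fintype n] [DecidableEq n] {β : ℝ}
    (hβ : β ∈ Set.Ioo (0 : ℝ) 1) (C : Matrix n n ℂ) :
    IsClosed {p : Matrix n n ℂ × Matrix n n ℂ |
      p.1.PosSemidef ∧ p.2.PosSemidef ∧ LeRegularizedMean β C p.1 p.2} := by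
  refine isClosed_of_closure_subset fun p hp => ?_
  have h1 : p.1.PosSemidef :=
    closure_minimal (fun q hq => hq.1) (isClosed_posSemidef.preimage continuous_fst) hp
  have h2 : p.2.PosSemidef :=
    closure_minimal (fun q hq => hq.2.1) (isClosed_posSemidef.preimage continuous_snd) hp
  refine ⟨h1, h2, fun ε hε => ?_⟩
  rw [mem_closure_iff_frequently] at hp
  have hε2 : 0 < ε / 2 := half_pos hε
  have e1 : ∀ᶠ q : Matrix n n ℂ × Matrix n n ℂ in 𝓝 p, ‖p.1 - q.1‖ < ε / 2 := by
    have : Continuous fun q : Matrix n n ℂ × Matrix n n ℂ => ‖p.1 - q.1‖ := by fun_prop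
    exact this.continuousAt.eventually_lt_const (by simpa using hε2)
  have e2 : ∀ᶠ q : Matrix n n ℂ × Matrix n n ℂ in 𝓝 p, ‖p.2 - q.2‖ < ε / 2 := by
    have : Continuous fun q : Matrix n n ℂ × Matrix n n ℂ => ‖p.2 - q.2‖ := by fun_prop
    exact this.continuousAt.eventually_lt_const (by simpa using hε2)
  obtain ⟨q, ⟨hq1, hq2, hq⟩, hn1, hn2⟩ := (hp.and_eventually (e1.and e2)).exists
  have hd : ∀ M M' : Matrix n n ℂ, M + (ε : ℂ) • (1 : Matrix n n ℂ) -
      (M' + ((ε / 2 : ℝ) : ℂ) • (1 : Matrix n n ℂ)) =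
      M - M' + ((ε / 2 : ℝ) : ℂ) • (1 : Matrix n n ℂ) := by
    intro M M'
    have : (ε : ℂ) = ((ε / 2 : ℝ) : ℂ) + ((ε / 2 : ℝ) : ℂ) := by
      rw [← Complex.ofReal_add, add_halves]
    rw [this, add_smul]
    abel
  refine (hq (ε / 2) hε2).trans (posGeomMean_le_of_posDef_sub hβ (hq1.posDef_add_smul_one hε2)
    (hq2.posDef_add_smul_one hε2) ?_ ?_)
  · rw [hd]
    exact posDef_of_norm_lt (h1.isHermitian.sub hq1.isHermitian) hn1
  · rw [hd]
    exact posDef_of_norm_lt (h2.isHermitian.sub hq2.isHermitian) hn2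

theorem LeRegularizedMean.add {n : Type*} [Fintype n] [DecidableEq n] {β : ℝ}
    (hβ : β ∈ Set.Ioo (0 : ℝ) 1) {C₁ J₁ A₁ C₂ J₂ A₂ : Matrix n n ℂ}
    (hJ₁ : J₁.PosSemidef) (hA₁ : A₁.PosSemidef) (hJ₂ : J₂.PosSemidef) (hA₂ : A₂.PosSemidef)
    (h₁ : LeRegularizedMean β C₁ J₁ A₁) (h₂ : LeRegularizedMean β C₂ J₂ A₂) :
    LeRegularizedMean β (C₁ + C₂) (J₁ + J₂) (A₁ + A₂) := by
  intro ε hε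
  have hε2 : 0 < ε / 2 := half_pos hε
  have hd : ∀ M M' : Matrix n n ℂ, M + M' + (ε : ℂ) • (1 : Matrix n n ℂ) =
      (M + ((ε / 2 : ℝ) : ℂ) • (1 : Matrix n n ℂ)) +
        (M' + ((ε / 2 : ℝ) : ℂ) • (1 : Matrix n n ℂ)) := by
    intro M M'
    have : (ε : ℂ) = ((ε / 2 : ℝ) : ℂ) + ((ε / 2 : ℝ) : ℂ) := by
      rw [← Complex.ofReal_add, add_halves]
    rw [this, add_smul]
    abel
  rw [hd, hd]
  refine (add_le_add (h₁ _ hε2) (h₂ _ hε2)).trans ?_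
  exact posSemidef_posGeomMean_add_sub hβ (hJ₁.posDef_add_smul_one hε2)
    (hA₁.posDef_add_smul_one hε2) (hJ₂.posDef_add_smul_one hε2) (hA₂.posDef_add_smul_one hε2)

theorem LeRegularizedMean.smul {n : Type*} [Fintype n] [DecidableEq n] {β : ℝ}
    {C J A : Matrix n n ℂ} (hJ : J.PosSemidef) (h : LeRegularizedMean β C J A) {c : ℝ}
    (hc : 0 < c) : LeRegularizedMean β (c • C) (c • J) (c • A) := by
  intro ε hε
  have hd : ∀ M : Matrix n n ℂ, c • M + (ε : ℂ) • (1 : Matrix n n ℂ) =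
      c • (M + ((ε / c : ℝ) : ℂ) • (1 : Matrix n n ℂ)) := by
    intro M
    rw [smul_add, Complex.coe_smul, Complex.coe_smul, smul_smul, mul_div_cancel₀ _ hc.ne']
  have hεc : 0 < ε / c := div_pos hε hc
  rw [hd, hd, posGeomMean_smul (hJ.posDef_add_smul_one hεc) _ hc, Matrix.le_iff, ← smul_sub]
  exact (Matrix.le_iff.mp (h _ hεc)).smul hc.le

theorem LeRegularizedMean.submatrix {m n : Type*} [Fintype m] [DecidableEq m] [Fintype n]
    [DecidableEq n] {β : ℝ} {C J A : Matrix n n ℂ} (hJ : J.PosSemidef) (hA : A.PosSemidef)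
    (h : LeRegularizedMean β C J A) (e : m ≃ n) :
    LeRegularizedMean β (C.submatrix e e) (J.submatrix e e) (A.submatrix e e) := by
  intro ε hε
  have hd : ∀ M : Matrix n n ℂ, M.submatrix e e + (ε : ℂ) • (1 : Matrix m m ℂ) =
      (M + (ε : ℂ) • (1 : Matrix n n ℂ)).submatrix e e := by
    intro M
    rw [Matrix.submatrix_add, Matrix.submatrix_smul, Pi.add_apply, Pi.add_apply, Pi.smul_apply,
      Pi.smul_apply, Matrix.submatrix_one_equiv]
  rw [hd, hd, posGeomMean_submatrix e (hJ.posDef_add_smul_one hε).isHermitian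
    (hA.posDef_add_smul_one hε).isHermitian]
  exact (Matrix.le_iff.mp (h ε hε)).submatrix e

/-- The regularized means of multiples `t • C` and `a • C` dominate `C` if `t ^ (1 - β) * a ^ β`
equals `1`. -/
theorem leRegularizedMean_smul_self {n : Type*} [Fintype n] [DecidableEq n] {β : ℝ}
    (hβ : β ∈ Set.Ioo (0 : ℝ) 1) {C : Matrix n n ℂ} (hC : C.PosSemidef) {t a : ℝ} (ht : 0 < t)
    (ha : 0 < a) (hta : (a / t) ^ β * t = 1) : LeRegularizedMean β C (t • C) (a • C) := by
  intro ε hε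
  -- So small that `c • (C + δ)` lies strictly below `c • C + ε` for both `c = t` and `c = a`; the
  -- mean of these smaller multiples is exactly `C + δ`.
  obtain ⟨δ, hδ, h1, h2⟩ : ∃ δ : ℝ, 0 < δ ∧ t * δ < ε ∧ a * δ < ε := by
    refine ⟨ε / (2 * (t + a)), by positivity, ?_, ?_⟩ <;>
    · rw [mul_div_assoc', div_lt_iff₀ (by positivity)]
      nlinarith [mul_pos hε ht, mul_pos hε ha]
  have hD := hC.posDef_add_smul_one hδ
  have hd : ∀ c : ℝ, c * δ < ε → (c • C + (ε : ℂ) • (1 : Matrix n n ℂ) -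
      c • (C + (δ : ℂ) • (1 : Matrix n n ℂ))).PosDef := by
    intro c hc
    rw [smul_add, add_sub_add_left_eq_sub, Complex.coe_smul, Complex.coe_smul, smul_smul,
      ← sub_smul]
    exact posDef_smul_one (sub_pos.mpr hc)
  have hm := posGeomMean_le_of_posDef_sub hβ (hD.smul ht) (hD.smul ha) (hd t h1) (hd a h2)
  have he : a • (C + (δ : ℂ) • (1 : Matrix n n ℂ)) =
      (a / t) • t • (C + (δ : ℂ) • (1 : Matrix n n ℂ)) := by
    rw [smul_smul, div_mul_cancel₀ _ ht.ne']
  rw [he, posGeomMean_smul_self (hD.smul ht), smul_smul, hta, one_smul] at hm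
  refine le_trans ?_ hm
  rw [Matrix.le_iff, add_sub_cancel_left]
  exact (posDef_smul_one hδ).posSemidef

end LoewnerOrder

/-! ### Choi matrices -/

/-- Complete positivity is applied to the unnormalized maximally entangled state, the rank-one
matrix of `w`, with an ancilla of dimension `card X`. -/
theorem posSemidef_choi {X Y : Type*} [Fintype X] [DecidableEq X]
    {N : Matrix X X ℂ →ₗ[ℂ] Matrix Y Y ℂ} (hN : IsCompletelyPositive N) :
    (choi N).PosSemidef := by
  let f : Fin (Fintype.card X) ≃ X := (Fintype.equivFin X).symm
  let w : Fin (Fintype.card X) × X → ℂ := fun p => if f p.1 = p.2 then 1 else 0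
  have h := hN (Fintype.card X) _ (Matrix.posSemidef_vecMulVec_self_star w)
  rw [← Matrix.posSemidef_submatrix_equiv (f.prodCongr (Equiv.refl Y))]
  convert h using 1
  ext p q
  simp only [choi, Matrix.submatrix_apply, Matrix.of_apply, Equiv.prodCongr_apply, Prod.map_fst,
    Prod.map_snd, Equiv.refl_apply]
  refine congrArg (fun M => N M p.2 q.2) ?_
  ext x x'
  simp only [Matrix.single_apply, Matrix.vecMulVec_apply, Matrix.of_apply, w, Pi.star_apply]
  split_ifs <;> simp_all

/-- Up to regrouping of indices this is a tensor power, from which both positivity and permutation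
invariance follow. -/
theorem choi_channelPow_apply {X Y : Type*} [Fintype X] [DecidableEq X]
    (N : Matrix X X ℂ →ₗ[ℂ] Matrix Y Y ℂ) {k : ℕ} (p q : (Fin k → X) × (Fin k → Y)) :
    choi (channelPow N k) p q = ∏ i, choi N (p.1 i, p.2 i) (q.1 i, q.2 i) := by
  simp only [choi, channelPow, Matrix.of_apply, LinearMap.coe_mk, AddHom.coe_mk, tensorProd]
  rw [Finset.sum_eq_single p.1, Finset.sum_eq_single q.1]
  · simp
  · intro b _ hb
    rw [Matrix.single_apply_of_col_ne _ _ hb.symm, zero_smul]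
  · simp
  · intro b _ hb
    refine Finset.sum_eq_zero fun c _ => ?_
    rw [Matrix.single_apply_of_row_ne hb.symm, zero_smul]
  · simp

open scoped MatrixOrder in
theorem posSemidef_tensorProd_const {X : Type*} [Fintype X] {k : ℕ}
    {M : Matrix X X ℂ} (hM : M.PosSemidef) :
    (tensorProd fun _ : Fin k => M).PosSemidef := by
  classical
  obtain ⟨B, rfl⟩ :=
    CStarAlgebra.nonneg_iff_eq_star_mul_self.mp (Matrix.nonneg_iff_posSemidef.mpr hM)
  have : (tensorProd fun _ : Fin k => star B * B) =
      (tensorProd fun _ : Fin k => B)ᴴ * tensorProd fun _ : Fin k => B := by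
    ext x x'
    simp only [tensorProd, Matrix.of_apply, Matrix.mul_apply, Matrix.conjTranspose_apply,
      Matrix.star_apply, Finset.prod_univ_sum, Fintype.piFinset_univ, Finset.prod_mul_distrib,
      star_prod]
  rw [this]
  exact Matrix.posSemidef_conjTranspose_mul_self _

theorem posSemidef_choi_channelPow {X Y : Type*} [Fintype X] [DecidableEq X] [Fintype Y]
    {N : Matrix X X ℂ →ₗ[ℂ] Matrix Y Y ℂ} (hN : IsCompletelyPositive N) (k : ℕ) :
    (choi (channelPow N k)).PosSemidef := by
  have h := (posSemidef_tensorProd_const (k := k) (posSemidef_choi hN)).submatrix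
    fun (p : (Fin k → X) × (Fin k → Y)) i => (p.1 i, p.2 i)
  convert h using 1
  ext p q
  exact choi_channelPow_apply N p q

/-! ### Relabelling the tensor factors -/

/-- The relabelling of the basis of the tensor power under a permutation of the factors. -/
def permEquiv (X : Type*) {k : ℕ} (π : Equiv.Perm (Fin k)) : (Fin k → X) ≃ (Fin k → X) :=
  π.arrowCongr (Equiv.refl X)

/-- The relabelling of the basis of a pair of tensor powers. -/
def permEquivPair (X Y : Type*) {k : ℕ} (π : Equiv.Perm (Fin k)) :
    (Fin k → X) × (Fin k → Y) ≃ (Fin k → X) × (Fin k → Y) :=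
  (permEquiv X π).prodCongr (permEquiv Y π)

theorem permEquiv_mul (X : Type*) {k : ℕ} (π σ : Equiv.Perm (Fin k)) :
    permEquiv X (π * σ) = (permEquiv X σ).trans (permEquiv X π) := rfl

theorem permEquivPair_mul (X Y : Type*) {k : ℕ} (π σ : Equiv.Perm (Fin k)) :
    permEquivPair X Y (π * σ) = (permEquivPair X Y σ).trans (permEquivPair X Y π) := rfl

theorem permOp_eq (X : Type*) [DecidableEq X] {k : ℕ} (π : Equiv.Perm (Fin k)) :
    permOp X π = (1 : Matrix (Fin k → X) (Fin k → X) ℂ).submatrix id (permEquiv X π) := by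
  ext x x'
  simp only [permOp, Matrix.of_apply, Matrix.submatrix_apply, Matrix.one_apply, id]
  rfl

theorem permOp_kronecker_permOp (X Y : Type*) [DecidableEq X] [DecidableEq Y] {k : ℕ}
    (π : Equiv.Perm (Fin k)) : permOp X π ⊗ₖ permOp Y π =
      (1 : Matrix ((Fin k → X) × (Fin k → Y)) ((Fin k → X) × (Fin k → Y)) ℂ).submatrix id
        (permEquivPair X Y π) := by
  rw [← Matrix.one_kronecker_one, permOp_eq, permOp_eq]
  rfl

theorem mul_submatrix_one_comm {n : Type*} [Fintype n] [DecidableEq n] {T : Matrix n n ℂ}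
    {e : n ≃ n} (h : T.submatrix e e = T) :
    T * (1 : Matrix n n ℂ).submatrix id e = (1 : Matrix n n ℂ).submatrix id e * T := by
  rw [Matrix.one_submatrix_mul, show (id : n → n) = Equiv.refl n from rfl,
    Matrix.mul_submatrix_one]
  ext i j
  have := congrFun (congrFun h (e.symm i)) j
  simpa using this

theorem isPermInvariant_of_submatrix {Y : Type*} [Fintype Y] [DecidableEq Y] {k : ℕ}
    {T : Matrix (Fin k → Y) (Fin k → Y) ℂ}
    (h : ∀ π : Equiv.Perm (Fin k), T.submatrix (permEquiv Y π) (permEquiv Y π) = T) :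
    IsPermInvariant T := fun π => by
  rw [permOp_eq]
  exact mul_submatrix_one_comm (h π)

theorem isPermInvariantPair_of_submatrix {X Y : Type*} [Fintype X] [DecidableEq X] [Fintype Y]
    [DecidableEq Y] {k : ℕ}
    {T : Matrix ((Fin k → X) × (Fin k → Y)) ((Fin k → X) × (Fin k → Y)) ℂ}
    (h : ∀ π : Equiv.Perm (Fin k),
      T.submatrix (permEquivPair X Y π) (permEquivPair X Y π) = T) :
    IsPermInvariantPair T := fun π => by
  rw [permOp_kronecker_permOp]
  exact mul_submatrix_one_comm (h π)

theorem choi_channelPow_submatrix {X Y : Type*} [Fintype X] [DecidableEq X]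
    (N : Matrix X X ℂ →ₗ[ℂ] Matrix Y Y ℂ) {k : ℕ} (π : Equiv.Perm (Fin k)) :
    (choi (channelPow N k)).submatrix (permEquivPair X Y π) (permEquivPair X Y π) =
      choi (channelPow N k) := by
  ext p q
  rw [Matrix.submatrix_apply, choi_channelPow_apply, choi_channelPow_apply]
  exact Equiv.prod_comp π.symm fun i => choi N (p.1 i, p.2 i) (q.1 i, q.2 i)

/-- Averaging a matrix over the relabellings of a group makes it invariant. -/
theorem sum_submatrix_invariant {G n : Type*} [Group G] [Fintype G] (e : G → n ≃ n)
    (he : ∀ g h, e (g * h) = (e h).trans (e g)) (c : ℝ) (M : Matrix n n ℂ) (h : G) :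
    (∑ g, c • M.submatrix (e g) (e g)).submatrix (e h) (e h) =
      ∑ g, c • M.submatrix (e g) (e g) := by
  ext i j
  simp only [Matrix.submatrix_apply, Matrix.sum_apply, Matrix.smul_apply]
  -- Right translation by `h` permutes the summands.
  rw [← Equiv.sum_comp (Equiv.mulRight h) fun g => c • M (e g i) (e g j)]
  refine Finset.sum_congr rfl fun g _ => ?_
  rw [Equiv.coe_mulRight, he]
  rfl

/-! ### Partial trace, partial transpose and operator norm -/

theorem partialTraceRight_add {m n : Type*} [Fintype n] (A B : Matrix (m × n) (m × n) ℂ) :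
    partialTraceRight (A + B) = partialTraceRight A + partialTraceRight B := by
  ext i j
  simp [partialTraceRight, Finset.sum_add_distrib]

theorem partialTraceRight_smul {m n : Type*} [Fintype n] (c : ℝ)
    (A : Matrix (m × n) (m × n) ℂ) :
    partialTraceRight (c • A) = c • partialTraceRight A := by
  ext i j
  simp [partialTraceRight, Finset.mul_sum]

theorem partialTraceRight_submatrix {m n : Type*} [Fintype n] (A : Matrix (m × n) (m × n) ℂ)
    (e : m ≃ m) (f : n ≃ n) :
    partialTraceRight (A.submatrix (e.prodCongr f) (e.prodCongr f)) =
      (partialTraceRight A).submatrix e e := by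
  ext i j
  exact Equiv.sum_comp f fun l => A (e i, l) (e j, l)

theorem continuous_partialTraceRight {m n : Type*} [Fintype n] :
    Continuous (partialTraceRight : Matrix (m × n) (m × n) ℂ → Matrix m m ℂ) := by
  refine continuous_matrix fun i j => ?_
  simp only [partialTraceRight, Matrix.of_apply]
  fun_prop

theorem trace_partialTraceRight {m n : Type*} [Fintype m] [Fintype n]
    (A : Matrix (m × n) (m × n) ℂ) : (partialTraceRight A).trace = A.trace := by
  simp [partialTraceRight, Matrix.trace, Fintype.sum_prod_type]

theorem isHermitian_partialTraceRight {m n : Type*} [Fintype n]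
    {A : Matrix (m × n) (m × n) ℂ} (hA : A.IsHermitian) :
    (partialTraceRight A).IsHermitian := by
  ext i j
  simp only [partialTraceRight, Matrix.conjTranspose_apply, Matrix.of_apply, star_sum]
  exact Finset.sum_congr rfl fun l _ => hA.apply _ _

theorem continuous_partialTransposeRight {m n : Type*} :
    Continuous (partialTransposeRight : Matrix (m × n) (m × n) ℂ → Matrix (m × n) (m × n) ℂ) := by
  refine continuous_matrix fun i j => ?_
  simp only [partialTransposeRight, Matrix.of_apply]
  fun_prop

theorem isHermitian_partialTransposeRight {m n : Type*}
    {A : Matrix (m × n) (m × n) ℂ} (hA : A.IsHermitian) :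
    (partialTransposeRight A).IsHermitian := by
  ext p q
  exact hA.apply _ _

theorem partialTransposeRight_one {m n : Type*} [DecidableEq m] [DecidableEq n] :
    partialTransposeRight (1 : Matrix (m × n) (m × n) ℂ) = 1 := by
  ext p q
  simp only [partialTransposeRight, Matrix.of_apply, Matrix.one_apply, Prod.ext_iff]
  congr 1
  simp only [eq_comm (a := q.2)]

section Norm

open scoped MatrixOrder Matrix.Norms.L2Operator

theorem opNorm_eq_norm {n : Type*} [Fintype n] [DecidableEq n] (A : Matrix n n ℂ) :
    opNorm A = ‖A‖ := rfl

theorem continuous_opNorm {n : Type*} [Fintype n] [DecidableEq n] :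
    Continuous (opNorm : Matrix n n ℂ → ℝ) :=
  continuous_norm

/-- Star homomorphisms of C*-algebras are contractive. -/
theorem opNorm_submatrix_le {m n : Type*} [Fintype m] [DecidableEq m] [Fintype n] [DecidableEq n]
    (e : m ≃ n) (A : Matrix n n ℂ) : opNorm (A.submatrix e e) ≤ opNorm A :=
  NonUnitalStarAlgHom.norm_apply_le (submatrixStarAlgHom e) A

theorem convex_opNorm_le {n : Type*} [Fintype n] [DecidableEq n] (c : ℝ) :
    Convex ℝ {A : Matrix n n ℂ | opNorm A ≤ c} := by
  have : {A : Matrix n n ℂ | opNorm A ≤ c} = Metric.closedBall 0 c := by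
    ext A
    simp [opNorm_eq_norm]
  rw [this]
  exact convex_closedBall 0 c

theorem Matrix.IsHermitian.posSemidef_opNorm_smul_sub {n : Type*} [Fintype n] [DecidableEq n]
    {A : Matrix n n ℂ} (hA : A.IsHermitian) : (opNorm A • (1 : Matrix n n ℂ) - A).PosSemidef := by
  have h := IsSelfAdjoint.le_algebraMap_norm_self (show IsSelfAdjoint A from hA)
  rwa [Matrix.le_iff, Algebra.algebraMap_eq_smul_one] at h

theorem Matrix.IsHermitian.posSemidef_opNorm_smul_add {n : Type*} [Fintype n] [DecidableEq n]
    {A : Matrix n n ℂ} (hA : A.IsHermitian) : (opNorm A • (1 : Matrix n n ℂ) + A).PosSemidef := by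
  have h := hA.neg.posSemidef_opNorm_smul_sub
  rwa [opNorm_eq_norm, norm_neg, sub_neg_eq_add] at h

theorem Matrix.IsHermitian.trace_re_le {n : Type*} [Fintype n] [DecidableEq n]
    {A : Matrix n n ℂ} (hA : A.IsHermitian) : A.trace.re ≤ Fintype.card n * opNorm A := by
  have h := (Complex.le_def.mp hA.posSemidef_opNorm_smul_sub.trace_nonneg).1
  rw [Matrix.trace_sub, Matrix.trace_smul, Matrix.trace_one] at h
  simp at h
  linarith

end Norm

/-! ### The feasible set of the program -/

section Program

variable {X Y : Type*} [Fintype X] [DecidableEq X] [Fintype Y] [DecidableEq Y]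

theorem one_div_mem_Ioo {α : ℝ} (hα : 1 < α) : 1 / α ∈ Set.Ioo (0 : ℝ) 1 :=
  ⟨by positivity, (div_lt_one (by positivity)).mpr hα⟩

/-- The feasible points of the program as a set of quadruples. -/
def feasibleSet (α : ℝ) (N : Matrix X X ℂ →ₗ[ℂ] Matrix Y Y ℂ) (k : ℕ) :
    Set (Matrix ((Fin k → X) × (Fin k → Y)) ((Fin k → X) × (Fin k → Y)) ℂ ×
      Matrix ((Fin k → X) × (Fin k → Y)) ((Fin k → X) × (Fin k → Y)) ℂ ×
      Matrix ((Fin k → X) × (Fin k → Y)) ((Fin k → X) × (Fin k → Y)) ℂ ×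
      Matrix (Fin k → Y) (Fin k → Y) ℂ) :=
  {p | UpsilonFeasible α N k p.1 p.2.1 p.2.2.1 p.2.2.2}

theorem convex_feasibleSet {α : ℝ} (hα : 1 < α) (N : Matrix X X ℂ →ₗ[ℂ] Matrix Y Y ℂ) (k : ℕ) :
    Convex ℝ (feasibleSet α N k) := by
  have hβ := one_div_mem_Ioo hα
  rw [convex_iff_forall_pos]
  rintro ⟨A, R, J, S⟩ h ⟨A', R', J', S'⟩ h' a b ha hb hab
  have comb : ∀ {n : Type _} {M M' : Matrix n n ℂ}, M.PosSemidef → M'.PosSemidef →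
      (a • M + b • M').PosSemidef := fun h h' => (h.smul ha.le).add (h'.smul hb.le)
  have hJ : J.PosSemidef := h.posSemidef_J
  have hA : A.PosSemidef := h.posSemidef_A
  have hJ' : J'.PosSemidef := h'.posSemidef_J
  have hA' : A'.PosSemidef := h'.posSemidef_A
  refine ⟨comb h.posSemidef_A h'.posSemidef_A, comb h.posSemidef_R h'.posSemidef_R,
    comb h.posSemidef_J h'.posSemidef_J, ?_, ?_, ?_, ?_, ?_, ?_, ?_⟩
  · exact (h.posSemidef_S.smul ha.le).add (h'.posSemidef_S.smul hb.le)
  · refine (loewnerLE_geomMean_iff hβ (comb hJ hJ') (comb hA hA')).mpr ?_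
    have h1 := ((loewnerLE_geomMean_iff hβ hJ hA).mp h.choi_le).smul hJ ha
    have h2 := ((loewnerLE_geomMean_iff hβ hJ' hA').mp h'.choi_le).smul hJ' hb
    have := h1.add hβ (hJ.smul ha.le) (hA.smul ha.le) (hJ'.smul hb.le) (hA'.smul hb.le) h2
    -- The two bounds add up to `a • C + b • C = C`.
    rwa [← add_smul, hab, one_smul] at this
  · convert comb h.R_add h'.R_add using 1
    ext p q
    simp [partialTransposeRight]
    ring
  · convert comb h.R_sub h'.R_sub using 1
    ext p q
    simp [partialTransposeRight]
    ring
  · convert comb h.S_add h'.S_add using 1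
    ext p q
    simp [partialTransposeRight]
    ring
  · convert comb h.S_sub h'.S_sub using 1
    ext p q
    simp [partialTransposeRight]
    ring
  · have h1 : S.trace.re ≤ 1 := h.trace_S
    have h2 : S'.trace.re ≤ 1 := h'.trace_S
    show (a • S + b • S').trace.re ≤ 1
    rw [Matrix.trace_add, Matrix.trace_smul, Matrix.trace_smul, Complex.add_re, Complex.smul_re,
      Complex.smul_re, smul_eq_mul, smul_eq_mul]
    nlinarith

theorem UpsilonFeasible.submatrix {α : ℝ} (hα : 1 < α) {N : Matrix X X ℂ →ₗ[ℂ] Matrix Y Y ℂ}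
    {k : ℕ} {A R J : Matrix ((Fin k → X) × (Fin k → Y)) ((Fin k → X) × (Fin k → Y)) ℂ}
    {S : Matrix (Fin k → Y) (Fin k → Y) ℂ} (h : UpsilonFeasible α N k A R J S)
    (π : Equiv.Perm (Fin k)) :
    UpsilonFeasible α N k (A.submatrix (permEquivPair X Y π) (permEquivPair X Y π))
      (R.submatrix (permEquivPair X Y π) (permEquivPair X Y π))
      (J.submatrix (permEquivPair X Y π) (permEquivPair X Y π))
      (S.submatrix (permEquiv Y π) (permEquiv Y π)) := by
  have hβ := one_div_mem_Ioo hα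
  have hone : ((1 : Matrix (Fin k → X) (Fin k → X) ℂ) ⊗ₖ
      S.submatrix (permEquiv Y π) (permEquiv Y π)) =
      ((1 : Matrix (Fin k → X) (Fin k → X) ℂ) ⊗ₖ S).submatrix (permEquivPair X Y π)
        (permEquivPair X Y π) := by
    conv_lhs => rw [← Matrix.submatrix_one_equiv (permEquiv X π)]
    rfl
  refine ⟨h.posSemidef_A.submatrix _, h.posSemidef_R.submatrix _, h.posSemidef_J.submatrix _,
    h.posSemidef_S.submatrix _, ?_, h.R_add.submatrix _, h.R_sub.submatrix _, ?_, ?_, ?_⟩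
  · rw [loewnerLE_geomMean_iff hβ (h.posSemidef_J.submatrix _) (h.posSemidef_A.submatrix _),
      ← choi_channelPow_submatrix N π]
    exact ((loewnerLE_geomMean_iff hβ h.posSemidef_J h.posSemidef_A).mp h.choi_le).submatrix
      h.posSemidef_J h.posSemidef_A _
  · rw [hone]
    exact h.S_add.submatrix _
  · rw [hone]
    exact h.S_sub.submatrix _
  · have : (S.submatrix (permEquiv Y π) (permEquiv Y π)).trace = S.trace :=
      Equiv.sum_comp (permEquiv Y π) fun y => S y y
    rw [this]
    exact h.trace_S

theorem isClosed_feasibleSet {α : ℝ} (hα : 1 < α) (N : Matrix X X ℂ →ₗ[ℂ] Matrix Y Y ℂ)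
    (k : ℕ) : IsClosed (feasibleSet α N k) := by
  have hβ := one_div_mem_Ioo hα
  have hT := continuous_partialTransposeRight (m := Fin k → X) (n := Fin k → Y)
  have hK : Continuous fun S : Matrix (Fin k → Y) (Fin k → Y) ℂ =>
      (1 : Matrix (Fin k → X) (Fin k → X) ℂ) ⊗ₖ S := by
    refine continuous_matrix fun p q => ?_
    show Continuous fun S : Matrix (Fin k → Y) (Fin k → Y) ℂ =>
      (1 : Matrix (Fin k → X) (Fin k → X) ℂ) p.1 q.1 * S p.2 q.2
    fun_prop
  have hset : feasibleSet α N k =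
      (fun p => (p.2.2.1, p.1)) ⁻¹' {p : Matrix ((Fin k → X) × (Fin k → Y)) _ ℂ ×
        Matrix ((Fin k → X) × (Fin k → Y)) _ ℂ | p.1.PosSemidef ∧ p.2.PosSemidef ∧
          LeRegularizedMean (1 / α) (choi (channelPow N k)) p.1 p.2} ∩
      ((fun p => p.2.1) ⁻¹' {M | M.PosSemidef} ∩ ((fun p => p.2.2.2) ⁻¹' {M | M.PosSemidef} ∩
      ((fun p => p.2.1 + partialTransposeRight p.2.2.1) ⁻¹' {M | M.PosSemidef} ∩
      ((fun p => p.2.1 - partialTransposeRight p.2.2.1) ⁻¹' {M | M.PosSemidef} ∩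
      ((fun p => (1 : Matrix (Fin k → X) (Fin k → X) ℂ) ⊗ₖ p.2.2.2 +
        partialTransposeRight p.2.1) ⁻¹' {M | M.PosSemidef} ∩
      ((fun p => (1 : Matrix (Fin k → X) (Fin k → X) ℂ) ⊗ₖ p.2.2.2 -
        partialTransposeRight p.2.1) ⁻¹' {M | M.PosSemidef} ∩
      {p | p.2.2.2.trace.re ≤ 1})))))) := by
    ext p
    constructor
    · intro h
      exact ⟨⟨h.posSemidef_J, h.posSemidef_A,
        (loewnerLE_geomMean_iff hβ h.posSemidef_J h.posSemidef_A).mp h.choi_le⟩, h.posSemidef_R,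
        h.posSemidef_S, h.R_add, h.R_sub, h.S_add, h.S_sub, h.trace_S⟩
    · rintro ⟨⟨h1, h2, h3⟩, h4, h5, h6, h7, h8, h9, h10⟩
      exact ⟨h2, h4, h1, h5, (loewnerLE_geomMean_iff hβ h1 h2).mpr h3, h6, h7, h8, h9, h10⟩
  rw [hset]
  refine ((isClosed_leRegularizedMean hβ _).preimage (by fun_prop)).inter
    ((isClosed_posSemidef.preimage (by fun_prop)).inter
    ((isClosed_posSemidef.preimage (by fun_prop)).inter
    ((isClosed_posSemidef.preimage (by fun_prop)).inter
    ((isClosed_posSemidef.preimage (by fun_prop)).inter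
    ((isClosed_posSemidef.preimage (by fun_prop)).inter
    ((isClosed_posSemidef.preimage (by fun_prop)).inter
    (isClosed_le ?_ continuous_const)))))))
  fun_prop

theorem isCompact_forall_norm_apply_le {n : Type*} (r : ℝ) :
    IsCompact {M : Matrix n n ℂ | ∀ i j, ‖M i j‖ ≤ r} := by
  have : {M : Matrix n n ℂ | ∀ i j, ‖M i j‖ ≤ r} =
      Set.pi Set.univ fun _ => Set.pi Set.univ fun _ => Metric.closedBall (0 : ℂ) r := by
    ext M
    exact ⟨fun h i _ j _ => mem_closedBall_zero_iff.mpr (h i j),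
      fun h i j => mem_closedBall_zero_iff.mp (h i trivial j trivial)⟩
  rw [this]
  exact isCompact_univ_pi fun _ => isCompact_univ_pi fun _ => isCompact_closedBall 0 r

/-- The constraints `A ± B ≥ 0` bound entries by traces: `tr S ≤ 1` bounds `R`, and then `tr R`
bounds `J`. Only `A` needs the bound on the objective, through `tr A = tr (tr_Y A)`. -/
theorem isCompact_feasibleSet_inter {α : ℝ} (hα : 1 < α)
    (N : Matrix X X ℂ →ₗ[ℂ] Matrix Y Y ℂ) (k : ℕ) (c : ℝ) :
    IsCompact (feasibleSet α N k ∩ {p | opNorm (partialTraceRight p.1) ≤ c}) := by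
  have hφ : Continuous fun p : Matrix ((Fin k → X) × (Fin k → Y)) ((Fin k → X) × (Fin k → Y)) ℂ ×
      Matrix ((Fin k → X) × (Fin k → Y)) ((Fin k → X) × (Fin k → Y)) ℂ ×
      Matrix ((Fin k → X) × (Fin k → Y)) ((Fin k → X) × (Fin k → Y)) ℂ ×
      Matrix (Fin k → Y) (Fin k → Y) ℂ => opNorm (partialTraceRight p.1) :=
    continuous_opNorm.comp (continuous_partialTraceRight.comp continuous_fst)
  set x : ℝ := ((Fintype.card (Fin k → X) : ℕ) : ℝ)
  set m : ℝ := ((Fintype.card ((Fin k → X) × (Fin k → Y)) : ℕ) : ℝ)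
  refine IsCompact.of_isClosed_subset ((isCompact_forall_norm_apply_le (x * c)).prod
    ((isCompact_forall_norm_apply_le x).prod ((isCompact_forall_norm_apply_le (m * x)).prod
      (isCompact_forall_norm_apply_le 1))))
    ((isClosed_feasibleSet hα N k).inter (isClosed_le hφ continuous_const)) ?_
  rintro ⟨A, R, J, S⟩ ⟨h, hc⟩
  have hA : A.PosSemidef := h.posSemidef_A
  have hS : S.PosSemidef := h.posSemidef_S
  have htS : S.trace.re ≤ 1 := h.trace_S
  have hR : ∀ p q, ‖R p q‖ ≤ x := by
    intro p q
    -- The swapped indices undo the partial transpose.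
    have h1 := norm_apply_le_trace_of_add_sub h.S_add h.S_sub (p.1, q.2) (q.1, p.2)
    refine (show ‖R p q‖ ≤ _ from h1).trans ?_
    rw [Matrix.trace_kronecker, Matrix.trace_one, ← Complex.ofReal_natCast, Complex.re_ofReal_mul]
    exact mul_le_of_le_one_right (Nat.cast_nonneg _) htS
  refine ⟨fun p q => ?_, hR, fun p q => ?_, fun p q => (hS.norm_apply_le_trace p q).trans htS⟩
  · refine (hA.norm_apply_le_trace p q).trans ?_
    rw [← trace_partialTraceRight]
    refine (isHermitian_partialTraceRight hA.isHermitian).trace_re_le.trans ?_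
    exact mul_le_mul_of_nonneg_left hc (Nat.cast_nonneg _)
  · have h1 := norm_apply_le_trace_of_add_sub h.R_add h.R_sub (p.1, q.2) (q.1, p.2)
    refine (show ‖J p q‖ ≤ _ from h1).trans ?_
    rw [Matrix.trace, Complex.re_sum]
    refine (Finset.sum_le_card_nsmul _ _ x fun i _ =>
      (Complex.re_le_norm _).trans (hR i i)).trans (le_of_eq ?_)
    rw [nsmul_eq_mul, Finset.card_univ]

theorem feasibleSet_nonempty {α : ℝ} (hα : 1 < α) {N : Matrix X X ℂ →ₗ[ℂ] Matrix Y Y ℂ}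
    (hN : IsCompletelyPositive N) (k : ℕ) : (feasibleSet α N k).Nonempty := by
  have hβ := one_div_mem_Ioo hα
  have hα0 : α ≠ 0 := by positivity
  set C := choi (channelPow N k) with hCdef
  have hC : C.PosSemidef := posSemidef_choi_channelPow hN k
  have hΓ := isHermitian_partialTransposeRight hC.isHermitian
  set r := opNorm (partialTransposeRight C) with hr
  have hr0 : 0 ≤ r := norm_nonneg _
  set y : ℝ := ((Fintype.card (Fin k → Y) : ℕ) : ℝ) with hy
  have hy0 : 0 ≤ y := Nat.cast_nonneg _
  -- Makes `t * r * y ≤ 1`, the trace constraint on `S`; the added ones keep the denominator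
  -- positive.
  set t : ℝ := ((r + 1) * (y + 1))⁻¹ with ht
  have ht0 : 0 < t := by positivity
  -- Solves `(a / t) ^ (1 / α) * t = 1`, so that the mean of `t • C` and `a • C` dominates `C`.
  set a : ℝ := t⁻¹ ^ α * t with ha
  have ha0 : 0 < a := by positivity
  have hta : (a / t) ^ (1 / α) * t = 1 := by
    rw [ha, mul_div_cancel_right₀ _ ht0.ne', ← Real.rpow_mul (by positivity),
      mul_one_div_cancel hα0, Real.rpow_one, inv_mul_cancel₀ ht0.ne']
  have hc0 : 0 ≤ t * r := by positivity
  have hsmul : ∀ (c : ℝ) (M : Matrix ((Fin k → X) × (Fin k → Y)) _ ℂ),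
      partialTransposeRight (c • M) = c • partialTransposeRight M := fun _ _ => rfl
  have hK : (1 : Matrix (Fin k → X) (Fin k → X) ℂ) ⊗ₖ
      ((t * r) • (1 : Matrix (Fin k → Y) (Fin k → Y) ℂ)) = (t * r) • 1 := by
    rw [Matrix.kronecker_smul, Matrix.one_kronecker_one]
  refine ⟨(a • C, (t * r) • 1, t • C, (t * r) • 1), hC.smul ha0.le, Matrix.PosSemidef.one.smul hc0,
    hC.smul ht0.le, Matrix.PosSemidef.one.smul hc0, ?_, ?_, ?_, ?_, ?_, ?_⟩
  · exact (loewnerLE_geomMean_iff hβ (hC.smul ht0.le) (hC.smul ha0.le)).mpr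
      (leRegularizedMean_smul_self hβ hC ht0 ha0 hta)
  · simp only [hsmul, mul_smul, ← smul_add]
    exact hΓ.posSemidef_opNorm_smul_add.smul ht0.le
  · simp only [hsmul, mul_smul, ← smul_sub]
    exact hΓ.posSemidef_opNorm_smul_sub.smul ht0.le
  · simp only [hK, hsmul, partialTransposeRight_one]
    exact (Matrix.PosSemidef.one.smul hc0).add (Matrix.PosSemidef.one.smul hc0)
  · simp only [hK, hsmul, partialTransposeRight_one, sub_self]
    exact Matrix.PosSemidef.zero
  · show ((t * r) • (1 : Matrix (Fin k → Y) (Fin k → Y) ℂ)).trace.re ≤ 1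
    rw [Matrix.trace_smul, Matrix.trace_one, Complex.smul_re, Complex.natCast_re, smul_eq_mul,
      ← hy, ht, mul_assoc, inv_mul_le_iff₀ (by positivity)]
    nlinarith

theorem exists_optimal {α : ℝ} (hα : 1 < α) {N : Matrix X X ℂ →ₗ[ℂ] Matrix Y Y ℂ}
    (hN : IsCompletelyPositive N) (k : ℕ) :
    ∃ p ∈ feasibleSet α N k, ∀ q ∈ feasibleSet α N k,
      opNorm (partialTraceRight p.1) ≤ opNorm (partialTraceRight q.1) := by
  obtain ⟨p₀, hp₀⟩ := feasibleSet_nonempty hα hN k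
  -- Minimize over the compact sublevel set of a feasible point; points outside it have a larger
  -- objective.
  obtain ⟨p, hp, hmin⟩ :=
    (isCompact_feasibleSet_inter hα N k (opNorm (partialTraceRight p₀.1))).exists_isMinOn
      ⟨p₀, hp₀, le_refl (opNorm (partialTraceRight p₀.1))⟩
      (continuous_opNorm.comp (continuous_partialTraceRight.comp continuous_fst)).continuousOn
  refine ⟨p, hp.1, fun q hq => ?_⟩
  rcases le_total (opNorm (partialTraceRight q.1)) (opNorm (partialTraceRight p₀.1)) with h | h
  · exact hmin ⟨hq, h⟩
  · exact le_trans hp.2 h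

end Program

theorem mainTheorem7 {X Y : Type*} [Fintype X] [DecidableEq X] [Fintype Y] [DecidableEq Y]
    (N : Matrix X X ℂ →ₗ[ℂ] Matrix Y Y ℂ) (hN : IsQuantumChannel N)
    (k : ℕ) (hk : 1 ≤ k) (α : ℝ) (hα : 1 < α) :
    ∃ (A R J : Matrix ((Fin k → X) × (Fin k → Y)) ((Fin k → X) × (Fin k → Y)) ℂ)
      (S : Matrix (Fin k → Y) (Fin k → Y) ℂ),
      UpsilonOptimal α N k A R J S ∧
      IsPermInvariantPair A ∧ IsPermInvariantPair R ∧ IsPermInvariantPair J ∧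
      IsPermInvariant S := by
  obtain ⟨⟨A, R, J, S⟩, hp, hmin⟩ := exists_optimal hα hN.completelyPositive k
  set w : ℝ := (Fintype.card (Equiv.Perm (Fin k)) : ℝ)⁻¹ with hw
  have hw0 : 0 ≤ w := by positivity
  have hw1 : ∑ _π : Equiv.Perm (Fin k), w = 1 := by
    rw [Finset.sum_const, Finset.card_univ, nsmul_eq_mul, hw, mul_inv_cancel₀]
    exact_mod_cast Fintype.card_ne_zero
  -- The uniform average of the relabelled optima is feasible by convexity.
  have havg := (convex_feasibleSet hα N k).sum_mem (t := Finset.univ) (w := fun _ => w)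
    (fun _ _ => hw0) hw1
    (fun π _ => show (_, _, _, _) ∈ feasibleSet α N k from UpsilonFeasible.submatrix hα hp π)
  have hobj := (convex_opNorm_le (n := Fin k → X) (opNorm (partialTraceRight A))).sum_mem
    (t := Finset.univ) (w := fun _ : Equiv.Perm (Fin k) => w) (fun _ _ => hw0) hw1
    (z := fun π => (partialTraceRight A).submatrix (permEquiv X π) (permEquiv X π))
    (fun π _ => opNorm_submatrix_le _ _)
  let E := permEquivPair X Y (k := k)
  let avg := fun M : Matrix ((Fin k → X) × (Fin k → Y)) ((Fin k → X) × (Fin k → Y)) ℂ =>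
    ∑ π, w • M.submatrix (E π) (E π)
  -- The partial trace of the average is the average of relabelled partial traces, whose norm `hobj`
  -- bounds by the optimum.
  have htr : partialTraceRight (avg A) =
      ∑ π, w • (partialTraceRight A).submatrix (permEquiv X π) (permEquiv X π) := by
    have h0 : partialTraceRight (0 : Matrix ((Fin k → X) × (Fin k → Y)) _ ℂ) = 0 := by
      ext i j
      simp [partialTraceRight]
    let L : Matrix ((Fin k → X) × (Fin k → Y)) ((Fin k → X) × (Fin k → Y)) ℂ →+
      Matrix (Fin k → X) (Fin k → X) ℂ := ⟨⟨partialTraceRight, h0⟩, partialTraceRight_add⟩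
    refine (map_sum L _ _).trans (Finset.sum_congr rfl fun π _ => ?_)
    refine (partialTraceRight_smul _ _).trans ?_
    rw [← partialTraceRight_submatrix A (permEquiv X π) (permEquiv Y π)]
    rfl
  refine ⟨avg A, avg R, avg J, ∑ π, w • S.submatrix (permEquiv Y π) (permEquiv Y π), ⟨?_, ?_⟩,
    isPermInvariantPair_of_submatrix (sum_submatrix_invariant E (permEquivPair_mul X Y) w A),
    isPermInvariantPair_of_submatrix (sum_submatrix_invariant E (permEquivPair_mul X Y) w R),
    isPermInvariantPair_of_submatrix (sum_submatrix_invariant E (permEquivPair_mul X Y) w J),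
    isPermInvariant_of_submatrix (sum_submatrix_invariant _ (permEquiv_mul Y) w S)⟩
  · simp only [feasibleSet, Set.mem_ofPred_eq, Prod.fst_sum, Prod.snd_sum, Prod.smul_fst,
      Prod.smul_snd] at havg
    exact havg
  · intro A' R' J' S' h'
    rw [htr]
    exact le_trans hobj (hmin (A', R', J', S') h')
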